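/- Let $M,N\ge 0$. The super Yangian $Y(\mathfrak{gl}_{M|N})$ is the associative superalgebra over $\mathbb{C}$ with generators $t_{ij}^{(r)}$ ($1\le i,j\le M+N$, $r\ge 0$), where $t_{ij}^{(0)}=\delta_{ij}$, and relations $$[t_{ij}^{(r)},t_{hk}^{(s)}]=(-1)^{\bar i\bar j+\bar i\bar h+\bar j\bar h}\sum_{q=0}^{\min(r,s)-1}\Big(t_{hj}^{(q)}t_{ik}^{(r+s-1-q)}-t_{hj}^{(r+s-1-q)}t_{ik}^{(q)}\Big),$$ where $\bar i=0$ for $i\le M$, $\bar i=1$ for $i>M$, the generator $t_{ij}^{(r)}$ has parity $\bar i+\bar j$, and $[\cdot,\cdot]$ denotes the supercommutator. Let $\lambda=(\mu_1,\dots,\mu_m)$ be a composition of $M$, let $\nu=(\mu_{m+1},\dots,\mu_{m+n})$ be a composition of $N$, put $\mu=(\mu_1,\dots,\mu_{m+n})$, and put $\bar a=0$ for $1\le a\le m$ and $\bar a=1$ for $m+1\le a\le m+n$. Let $T(u)=\big(\sum_{r\ge 0}t_{ij}^{(r)}u^{-r}\big)_{i,j}$, a matrix with entries in $Y(\mathfrak{gl}_{M|N})[[u^{-1}]]$.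 Then $T(u)$, divided into blocks of sizes $\mu_1,\dots,\mu_{m+n}$, has a unique Gauss decomposition $T(u)=F(u)D(u)E(u)$ with $F(u)$ block lower unitriangular, $E(u)$ block upper unitriangular and $D(u)$ block diagonal. Let $D_a(u)=\big(\sum_{r\ge 0}D_{a;i,j}^{(r)}u^{-r}\big)_{1\le i,j\le\mu_a}$ be the diagonal blocks of $D(u)$. Each $D_a(u)$ is invertible; write $D_a'(u)=D_a(u)^{-1}=\big(\sum_{r\ge 0}D_{a;i,j}^{\prime(r)}u^{-r}\big)_{i,j}$. The following relations hold for all $r,s\ge 0$ and all admissible $a,b,i,j,h,k$: $$D_{a;i,j}^{(0)}=\delta_{ij},\qquad \sum_{q=0}^{r}\sum_{p=1}^{\mu_a}D_{a;i,p}^{(q)}D_{a;p,j}^{\prime(r-q)}=\delta_{r0}\delta_{ij},$$ $$[D_{a;i,j}^{(r)},D_{b;h,k}^{(s)}]=\delta_{ab}\,(-1)^{\bar a}\sum_{q=0}^{\min(r,s)-1}\Big(D_{a;h,j}^{(q)}D_{a;i,k}^{(r+s-1-q)}-D_{a;h,j}^{(r+s-1-q)}D_{a;i,k}^{(q)}\Big).$$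 The elements $D_{a;i,j}^{(r)}$, $D_{a;i,j}^{\prime(r)}$ generate a subalgebra $Y_\mu^0$ of $Y(\mathfrak{gl}_{M|N})$ (the standard Levi subalgebra), and $Y_\mu^0$ is already generated by the elements $D_{a;i,j}^{(r)}$. -/

import Mathlib

open scoped PowerSeries

noncomputable section

namespace SuperYangian

/-- The parity of an index of `gl_{M|N}`: the first `M` of the `M + N` indices (counted
from `0`) are even, the remaining `N` are odd. -/
def parity (M : ℕ) {N : ℕ} (i : Fin (M + N)) : ℕ := if (i : ℕ) < M then 0 else 1

/-- The free associative algebra on symbols `t_{ij}^{(r)}`. -/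
abbrev Free (M N : ℕ) : Type := FreeAlgebra ℂ (Fin (M + N) × Fin (M + N) × ℕ)

/-- The symbol `t_{ij}^{(r)}` in the free algebra. -/
def Free.t {M N : ℕ} (i j : Fin (M + N)) (r : ℕ) : Free M N :=
  FreeAlgebra.ι ℂ (i, j, r)

/-- The defining relations of the super Yangian `Y(gl_{M|N})`. The left-hand side of the
second relation is the supercommutator of `t_{ij}^{(r)}` and `t_{hk}^{(s)}`, where
`t_{ij}^{(r)}` has parity `|i| + |j|`. -/
inductive Rel (M N : ℕ) : Free M N → Free M N → Prop
  | zero (i j : Fin (M + N)) : Rel M N (Free.t i j 0) (if i = j then 1 else 0)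
  | bracket (i j h k : Fin (M + N)) (r s : ℕ) :
      Rel M N
        (Free.t i j r * Free.t h k s
          - (-1 : ℂ) ^ ((parity M i + parity M j) * (parity M h + parity M k)) •
              (Free.t h k s * Free.t i j r))
        ((-1 : ℂ) ^ (parity M i * parity M j + parity M i * parity M h
            + parity M j * parity M h) •
          ∑ q ∈ Finset.range (min r s),
            (Free.t h j q * Free.t i k (r + s - 1 - q)
              - Free.t h j (r + s - 1 - q) * Free.t i k q))

end SuperYangian

/-- The super Yangian `Y(gl_{M|N})` over `ℂ`. -/
def SuperYangian (M N : ℕ) : Type := RingQuot (SuperYangian.Rel M N)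

namespace SuperYangian

instance (M N : ℕ) : Ring (SuperYangian M N) :=
  inferInstanceAs (Ring (RingQuot (Rel M N)))

instance (M N : ℕ) : Algebra ℂ (SuperYangian M N) :=
  inferInstanceAs (Algebra ℂ (RingQuot (Rel M N)))

/-- The quotient map from the free algebra to `Y(gl_{M|N})`. -/
def mk (M N : ℕ) : Free M N →ₐ[ℂ] SuperYangian M N :=
  RingQuot.mkAlgHom ℂ (Rel M N)

theorem mk_eq {M N : ℕ} {x y : Free M N} (h : Rel M N x y) : mk M N x = mk M N y :=
  RingQuot.mkAlgHom_rel ℂ h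

/-- The universal property of `Y(gl_{M|N})`: an algebra homomorphism from the free algebra
that respects the defining relations descends to the quotient. -/
def lift {M N : ℕ} {A : Type*} [Ring A] [Algebra ℂ A] (f : Free M N →ₐ[ℂ] A)
    (hf : ∀ ⦃x y⦄, Rel M N x y → f x = f y) : SuperYangian M N →ₐ[ℂ] A :=
  RingQuot.liftAlgHom ℂ ⟨f, hf⟩

theorem lift_mk {M N : ℕ} {A : Type*} [Ring A] [Algebra ℂ A] (f : Free M N →ₐ[ℂ] A)
    (hf : ∀ ⦃x y⦄, Rel M N x y → f x = f y) (x : Free M N) :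
    lift f hf (mk M N x) = f x :=
  RingQuot.liftAlgHom_mkAlgHom_apply ℂ f hf x

/-- The generator `t_{ij}^{(r)}` of `Y(gl_{M|N})`. -/
def t {M N : ℕ} (i j : Fin (M + N)) (r : ℕ) : SuperYangian M N :=
  mk M N (Free.t i j r)

/-- The algebra endomorphism of the free algebra multiplying `t_{ij}^{(r)}` by
`(-1)^{|i| + |j|}`. -/
def Free.sign (M N : ℕ) : Free M N →ₐ[ℂ] Free M N :=
  FreeAlgebra.lift ℂ fun x =>
    (-1 : ℂ) ^ (parity M x.1 + parity M x.2.1) • Free.t x.1 x.2.1 x.2.2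

theorem Free.sign_t {M N : ℕ} (i j : Fin (M + N)) (r : ℕ) :
    Free.sign M N (Free.t i j r) = (-1 : ℂ) ^ (parity M i + parity M j) • Free.t i j r := by
  simp [Free.sign, Free.t]

theorem Free.sign_mul {M N : ℕ} (i j h k : Fin (M + N)) (r s : ℕ) :
    Free.sign M N (Free.t i j r * Free.t h k s) =
      (-1 : ℂ) ^ (parity M i + parity M j + (parity M h + parity M k)) •
        (Free.t i j r * Free.t h k s) := by
  rw [map_mul, Free.sign_t, Free.sign_t, smul_mul_smul_comm, ← pow_add]

theorem mk_sign_eq {M N : ℕ} ⦃x y : Free M N⦄ (hxy : Rel M N x y) :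
    ((mk M N).comp (Free.sign M N)) x =
      ((mk M N).comp (Free.sign M N)) y := by
  have key : ∃ c : ℂ, Free.sign M N x = c • x ∧ Free.sign M N y = c • y := by
    induction hxy with
    | zero i j =>
      refine ⟨(-1 : ℂ) ^ (parity M i + parity M j), Free.sign_t i j 0, ?_⟩
      split_ifs with hij
      · subst hij
        rw [map_one, ← two_mul, pow_mul]
        simp
      · simp
    | bracket i j h k r s =>
      refine ⟨(-1 : ℂ) ^ (parity M i + parity M j + (parity M h + parity M k)), ?_, ?_⟩
      · have e : parity M h + parity M k + (parity M i + parity M j) =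
            parity M i + parity M j + (parity M h + parity M k) := by ring
        rw [map_sub, map_smul, Free.sign_mul, Free.sign_mul, smul_sub, e, smul_smul, smul_smul,
          mul_comm]
      · have e : parity M h + parity M j + (parity M i + parity M k) =
            parity M i + parity M j + (parity M h + parity M k) := by ring
        rw [map_smul, map_sum, smul_smul,
          mul_comm ((-1 : ℂ) ^ (parity M i + parity M j + (parity M h + parity M k))),
          ← smul_smul]
        refine congrArg _ ?_
        rw [Finset.smul_sum]
        refine Finset.sum_congr rfl fun q _ => ?_
        rw [map_sub, Free.sign_mul, Free.sign_mul, smul_sub, e]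
  obtain ⟨c, hx, hy⟩ := key
  rw [AlgHom.comp_apply, AlgHom.comp_apply, hx, hy, map_smul, map_smul,
    mk_eq hxy]

/-- The parity automorphism of `Y(gl_{M|N})`: it sends `t_{ij}^{(r)}` to
`(-1)^{|i| + |j|} t_{ij}^{(r)}`, so it is `1` on even and `-1` on odd elements. -/
def parityAut (M N : ℕ) : SuperYangian M N →ₐ[ℂ] SuperYangian M N :=
  lift ((mk M N).comp (Free.sign M N)) mk_sign_eq

/-- The even component of an element for the `ℤ/2`-grading. -/
def evenPart {M N : ℕ} (x : SuperYangian M N) : SuperYangian M N :=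
  (1 / 2 : ℂ) • (x + parityAut M N x)

/-- The odd component of an element for the `ℤ/2`-grading. -/
def oddPart {M N : ℕ} (x : SuperYangian M N) : SuperYangian M N :=
  (1 / 2 : ℂ) • (x - parityAut M N x)

/-- The supercommutator: the bilinear map with `[x, y] = x y - (-1)^{|x| |y|} y x` for
homogeneous `x` and `y`. The only sign occurs for two odd arguments. -/
def superBracket {M N : ℕ} (x y : SuperYangian M N) : SuperYangian M N :=
  x * y - (evenPart y * evenPart x + evenPart y * oddPart x
    + oddPart y * evenPart x - oddPart y * oddPart x)

/-- The matrix `T(u)`, whose entries `t_{ij}(u) = ∑ t_{ij}^{(r)} u^{-r}` are power series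
in the variable `X = u⁻¹`. -/
def T (M N : ℕ) : Matrix (Fin (M + N)) (Fin (M + N)) (SuperYangian M N)⟦X⟧ :=
  Matrix.of fun i j => PowerSeries.mk fun r => t i j r

/-- Row and column positions of block matrices of shape `c`: a block position `a` together
with an entry position in `{1, …, c_a}`. -/
abbrev BlockIndex {n : ℕ} (c : Composition n) : Type :=
  Σ a : Fin c.length, Fin (c.blocksFun a)

/-- `A = F D E` with `F` block lower unitriangular, `D` block diagonal with diagonal blocks
`D a`, and `E` block upper unitriangular, for the division of `A` into blocks of sizes
`c_1, c_2, …`. -/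
structure IsGaussDecomposition {R : Type*} [Ring R] {n : ℕ} (c : Composition n)
    (A : Matrix (Fin n) (Fin n) R) (F : Matrix (BlockIndex c) (BlockIndex c) R)
    (D : (a : Fin c.length) → Matrix (Fin (c.blocksFun a)) (Fin (c.blocksFun a)) R)
    (E : Matrix (BlockIndex c) (BlockIndex c) R) : Prop where
  lower : ∀ x y : BlockIndex c, x.1 < y.1 → F x y = 0
  lower_diag : ∀ a, Matrix.blockDiag' F a = 1
  upper : ∀ x y : BlockIndex c, y.1 < x.1 → E x y = 0
  upper_diag : ∀ a, Matrix.blockDiag' E a = 1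
  eq_mul : A.submatrix c.blocksFinEquiv c.blocksFinEquiv = F * Matrix.blockDiagonal' D * E

/-- The parity of a block position of the composition `(lam | nu)` of `(M | N)`: the blocks
coming from `lam` are even, those coming from `nu` are odd. -/
def blockParity {M N : ℕ} (lam : Composition M) (nu : Composition N)
    (a : Fin (lam.append nu).length) : ℕ :=
  if (a : ℕ) < lam.length then 0 else 1

/-- The coefficient of `u^{-r}` in the `(i, j)` entry of a matrix of power series in
`u⁻¹`. -/
def entryCoeff {R : Type*} [Ring R] {m : Type*} (A : Matrix m m R⟦X⟧) (i j : m) (r : ℕ) : R :=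
  PowerSeries.coeff r (A i j)

/-- The set of all elements `D_{a;i,j}^{(r)}`, `r ≥ 0`, for a family of square matrices
`D_a(u)` of power series in `u⁻¹`. -/
def coeffSet {R : Type*} [Ring R] {n : ℕ} {c : Composition n}
    (D : (a : Fin c.length) → Matrix (Fin (c.blocksFun a)) (Fin (c.blocksFun a)) R⟦X⟧) :
    Set R :=
  {x | ∃ a i j r, x = entryCoeff (D a) i j r}

/-- The standard Levi subalgebra attached to the diagonal blocks `D_a(u)`: the subalgebra
generated by the coefficients of all entries of the `D_a(u)` and of their inverses
`D'_a(u)`. -/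
def levi {M N : ℕ} {c : Composition (M + N)}
    (D : (a : Fin c.length) →
      Matrix (Fin (c.blocksFun a)) (Fin (c.blocksFun a)) (SuperYangian M N)⟦X⟧) :
    Subalgebra ℂ (SuperYangian M N) :=
  Algebra.adjoin ℂ (coeffSet D ∪ coeffSet fun a => Ring.inverse (D a))

end SuperYangian

end

/-! The diagonal blocks of a Gauss decomposition are quasideterminants. Let `A_a` be the leading
submatrix of blocks up to `a`. If `A = F D E`, then `E⁻¹ D⁻¹` is the only block upper triangular `V`
with `A V` block lower unitriangular, and its columns in block `a` are those of `A_a⁻¹`. Hence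
`D_a⁻¹` is the last diagonal block of `A_a⁻¹`. This yields existence and uniqueness (`exists_gauss`,
`gauss_eq`) and reduces the relations to facts about inverses and submatrices.

The defining relations are equivalent to the two-variable `RTT` relation
(`rtt_iff_isYangianMatrix`), which passes to submatrices and, with the two factors exchanged, to
inverses (`RTT.inverse`). Passing from `A_a` to its inverse, to a corner, and to the inverse again
exchanges the factors twice, so `D_a` satisfies the same relations as `T`, with the constant parity
of block `a`.

For `a < b`, the mixed relation `RTT.mul_inverse` shows that entries of `A_a` commute with those of
`D_b⁻¹`, which lie in other rows and columns of `A_b⁻¹`. Coefficients of an inverse stay in any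
subring containing those of the matrix (`coeff_mem_of_mul_eq_one`), so `D_a` and `D_b` commute; the
same fact removes the inverses from the generators of the Levi subalgebra. Finally, the entries of
`D_a` are even, so supercommutators between them are commutators. -/

section PowerSeriesMatrix

/-! ### Inverses of matrices of power series with constant term 1. -/

variable {ι R : Type*} [Fintype ι] [DecidableEq ι] [Ring R]

/-- A matrix of power series is the same as a power series of matrices. -/
noncomputable def Matrix.powerSeriesEquiv : Matrix ι ι R⟦X⟧ ≃+* (Matrix ι ι R)⟦X⟧ where
  toFun A := PowerSeries.mk fun r => A.map (PowerSeries.coeff r)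
  invFun f := Matrix.of fun i j => PowerSeries.mk fun r => PowerSeries.coeff r f i j
  left_inv A := by ext; simp
  right_inv f := by ext; simp
  map_add' A B := by ext; simp
  map_mul' A B := by
    ext r i j
    simp only [PowerSeries.coeff_mk, PowerSeries.coeff_mul, Matrix.map_apply, Matrix.mul_apply,
      map_sum, Matrix.sum_apply]
    exact Finset.sum_comm

/-- Viewed as a power series over the matrix ring, such a matrix has an invertible constant term,
which suffices even over a noncommutative ring. -/
theorem Matrix.isUnit_of_map_constantCoeff_eq_one {A : Matrix ι ι R⟦X⟧}
    (hA : A.map PowerSeries.constantCoeff = 1) : IsUnit A := by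
  rw [← MulEquiv.isUnit_map (Matrix.powerSeriesEquiv (ι := ι) (R := R)),
    PowerSeries.isUnit_iff_constantCoeff]
  have : PowerSeries.constantCoeff (Matrix.powerSeriesEquiv A) = 1 := by
    rw [← hA]
    ext i j
    simp [Matrix.powerSeriesEquiv]
  rw [this]
  exact isUnit_one

theorem Matrix.map_constantCoeff_eq_one_of_mul_eq_one {A B : Matrix ι ι R⟦X⟧}
    (hA : A.map PowerSeries.constantCoeff = 1) (hAB : A * B = 1) :
    B.map PowerSeries.constantCoeff = 1 := by
  have h := congrArg (fun M => M.map (PowerSeries.constantCoeff (R := R))) hAB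
  rwa [Matrix.map_mul, hA, Matrix.one_mul, Matrix.map_one _ (map_zero _) (map_one _)] at h

/-- The coefficients of the inverse of a matrix of power series with constant term `1` lie in
every subring that contains the coefficients of the matrix. -/
theorem Matrix.coeff_mem_of_mul_eq_one (S : Subring R) {A B : Matrix ι ι R⟦X⟧}
    (hA : A.map PowerSeries.constantCoeff = 1) (hS : ∀ i j r, PowerSeries.coeff r (A i j) ∈ S)
    (hBA : B * A = 1) (i j : ι) (r : ℕ) : PowerSeries.coeff r (B i j) ∈ S := by
  -- The matrix is inverted over `S` itself; the image of that inverse must be `B` by uniqueness of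
  -- inverses.
  let A' : Matrix ι ι S⟦X⟧ :=
    Matrix.of fun i j => PowerSeries.mk fun r => ⟨PowerSeries.coeff r (A i j), hS i j r⟩
  have hmap : A'.map (PowerSeries.map S.subtype) = A := by
    ext i j r
    simp [A']
  have hA' : A'.map PowerSeries.constantCoeff = 1 := by
    ext i j
    have := congrFun (congrFun hA i) j
    simp only [Matrix.map_apply, ← PowerSeries.coeff_zero_eq_constantCoeff_apply] at this ⊢
    simp only [A', Matrix.of_apply, PowerSeries.coeff_mk, this, Matrix.one_apply]
    split_ifs <;> rfl
  obtain ⟨B', hB', -⟩ := isUnit_iff_exists.1 (Matrix.isUnit_of_map_constantCoeff_eq_one hA')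
  have h : A * B'.map (PowerSeries.map S.subtype) = 1 := by
    rw [← hmap, ← Matrix.map_mul, hB']
    simp
  rw [left_inv_eq_right_inv hBA h]
  simp

end PowerSeriesMatrix

/-! ### Block unitriangular matrices. -/

section Unitriangular

variable {ι R : Type*} [Fintype ι] [DecidableEq ι] [Ring R]

/-- `E` is block upper unitriangular with respect to the block function `b`. -/
def Matrix.IsBlockUnitriangular (b : ι → ℕ) (E : Matrix ι ι R) : Prop :=
  ∀ x y, b y ≤ b x → E x y = (1 : Matrix ι ι R) x y

/-- Each factor `N` raises the block index by at least one, so `k` factors raise it by at least `k`.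
As `b` is bounded, `N` is nilpotent. -/
theorem Matrix.pow_apply_eq_zero_of_strictly_blockTriangular {b : ι → ℕ} {N : Matrix ι ι R}
    (hN : ∀ x y, b y ≤ b x → N x y = 0) (k : ℕ) :
    ∀ x y, b y < b x + k → (N ^ k) x y = 0 := by
  induction k with
  | zero =>
    intro x y h
    rw [pow_zero, Matrix.one_apply_ne]
    rintro rfl
    omega
  | succ k ih =>
    intro x y h
    rw [pow_succ, Matrix.mul_apply]
    refine Finset.sum_eq_zero fun z _ => ?_
    rcases lt_or_ge (b z) (b x + k) with hz | hz
    · rw [ih x z hz, zero_mul]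
    · rw [hN z y (by omega), mul_zero]

namespace Matrix.IsBlockUnitriangular

theorem isUnit {b : ι → ℕ} {E : Matrix ι ι R} (hE : E.IsBlockUnitriangular b) : IsUnit E := by
  have hnil : IsNilpotent (E - 1) := by
    refine ⟨Finset.univ.sup b + 1, ?_⟩
    ext x y
    refine Matrix.pow_apply_eq_zero_of_strictly_blockTriangular (b := b) ?_ _ x y ?_
    · intro x y h
      rw [Matrix.sub_apply, hE x y h, sub_self]
    · have := Finset.le_sup (f := b) (Finset.mem_univ y)
      omega
  simpa using hnil.isUnit_one_add

/-- Downward induction on the block of the row: in row `x` of `E * M`, the terms from higher blocks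
vanish by induction, and the others see `E` as the identity. With `E * M = 1` this shows that
inverses are again unitriangular. -/
theorem of_mul {b : ι → ℕ} {E M : Matrix ι ι R} (hE : E.IsBlockUnitriangular b)
    (h : (E * M).IsBlockUnitriangular b) : M.IsBlockUnitriangular b := by
  have key : ∀ d x, Finset.univ.sup b - b x = d → ∀ y, b y ≤ b x → M x y = (1 : Matrix ι ι R) x y := by
    intro d
    induction d using Nat.strong_induction_on with
    | _ d ih =>
      intro x hx y hxy
      rw [← h x y hxy, Matrix.mul_apply]
      have : ∀ z, E x z * M z y = (1 : Matrix ι ι R) x z * M z y := by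
        intro z
        rcases le_or_gt (b z) (b x) with hz | hz
        · rw [hE x z hz]
        · have hle := Finset.le_sup (f := b) (Finset.mem_univ z)
          have hzy : z ≠ y := by
            rintro rfl
            omega
          rw [ih _ (by omega) z rfl y (by omega), Matrix.one_apply_ne hzy, mul_zero, mul_zero]
      rw [Finset.sum_congr rfl fun z _ => this z, ← Matrix.mul_apply, one_mul]
  exact fun x => key _ x rfl

omit [Fintype ι] in
theorem one (b : ι → ℕ) : (1 : Matrix ι ι R).IsBlockUnitriangular b := fun _ _ _ => rfl

end Matrix.IsBlockUnitriangular

end Unitriangular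

/-! ### Block Gauss decomposition over a noncommutative ring. -/

section Gauss

variable {n : ℕ} {m : Fin n → Type*} [∀ a, Fintype (m a)] [∀ a, DecidableEq (m a)]
  {R : Type*} [Ring R]

namespace Matrix

/-- The leading block submatrix of all blocks up to `a`. -/
def leadingBlocks (A : Matrix (Σ a, m a) (Σ a, m a) R) (a : Fin n) :
    Matrix {x : Σ a, m a // x.1 ≤ a} {x : Σ a, m a // x.1 ≤ a} R :=
  A.submatrix Subtype.val Subtype.val

/-- The matrix whose columns in block `a` are the columns in block `a` of the inverse of the
leading submatrix of all blocks up to `a`. -/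
noncomputable def upperFactor (A : Matrix (Σ a, m a) (Σ a, m a) R) :
    Matrix (Σ a, m a) (Σ a, m a) R :=
  of fun x y => if h : x.1 ≤ y.1 then
    Ring.inverse (A.leadingBlocks y.1) ⟨x, h⟩ ⟨y, le_rfl⟩ else 0

theorem upperFactor_of_le (A : Matrix (Σ a, m a) (Σ a, m a) R) {x y : Σ a, m a}
    (h : x.1 ≤ y.1) :
    A.upperFactor x y = Ring.inverse (A.leadingBlocks y.1) ⟨x, h⟩ ⟨y, le_rfl⟩ :=
  dif_pos h

theorem upperFactor_of_not_le (A : Matrix (Σ a, m a) (Σ a, m a) R) {x y : Σ a, m a}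
    (h : ¬ x.1 ≤ y.1) : A.upperFactor x y = 0 :=
  dif_neg h

omit [∀ a, DecidableEq (m a)] in
theorem sum_eq_sum_leading {a : Fin n} (f : (Σ a, m a) → R) (hf : ∀ z, ¬ z.1 ≤ a → f z = 0) :
    ∑ z, f z = ∑ z : {x : Σ a, m a // x.1 ≤ a}, f z := by
  rw [← Finset.sum_filter_of_ne (p := fun z : Σ a, m a => z.1 ≤ a)
    (fun z _ hz => by_contra fun hne => hz (hf z hne))]
  exact (Finset.sum_subtype _ (by simp) f)

/-- On and above the block diagonal, a column of the product in block `a` only involves `A_a *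
A_a⁻¹`. The block function `n - x.1` reverses the order of the blocks, so that lower triangularity
becomes a case of `IsBlockUnitriangular`. -/
theorem isBlockUnitriangular_mul_upperFactor {A : Matrix (Σ a, m a) (Σ a, m a) R}
    (hA : ∀ a, IsUnit (A.leadingBlocks a)) :
    (A * A.upperFactor).IsBlockUnitriangular fun x => n - x.1 := by
  intro x y hxy
  have hxy' : x.1 ≤ y.1 := by
    have := x.1.2
    have := y.1.2
    simp only at hxy
    rw [Fin.le_def]
    omega
  have h : (A.leadingBlocks y.1 * Ring.inverse (A.leadingBlocks y.1)) ⟨x, hxy'⟩ ⟨y, le_rfl⟩ =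
      (1 : Matrix (Σ a, m a) (Σ a, m a) R) x y := by
    rw [Ring.mul_inverse_cancel _ (hA y.1)]
    simp [one_apply]
  rw [← h, mul_apply, mul_apply, sum_eq_sum_leading (a := y.1) _ fun z hz => by
    rw [upperFactor_of_not_le _ hz, mul_zero]]
  exact Finset.sum_congr rfl fun z _ => by rw [upperFactor_of_le _ z.2]; rfl

/-- The columns of `V` in block `a` are supported on the leading rows, where they solve `A_a * C =
I` with `I` the last block column of the identity; inverting `A_a` determines them. -/
theorem upperFactor_eq {A V : Matrix (Σ a, m a) (Σ a, m a) R}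
    (hA : ∀ a, IsUnit (A.leadingBlocks a)) (hV : ∀ x y, y.1 < x.1 → V x y = 0)
    (hAV : (A * V).IsBlockUnitriangular fun x => n - x.1) : A.upperFactor = V := by
  ext x y
  rcases lt_or_ge y.1 x.1 with hlt | hle
  · rw [hV x y hlt, upperFactor_of_not_le _ (not_le.2 hlt)]
  obtain ⟨a, j⟩ := y
  let C : Matrix {x : Σ a, m a // x.1 ≤ a} (m a) R := of fun z j => V z ⟨a, j⟩
  let I : Matrix {x : Σ a, m a // x.1 ≤ a} (m a) R :=
    of fun z j => (1 : Matrix (Σ a, m a) (Σ a, m a) R) z ⟨a, j⟩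
  have key : A.leadingBlocks a * C = I := by
    ext z j
    have h := hAV z.1 ⟨a, j⟩ (by have := Fin.le_def.1 z.2; simp only; omega)
    rw [mul_apply, sum_eq_sum_leading (a := a) _
      (fun z hz => by rw [hV z _ (not_le.1 hz), mul_zero])] at h
    rw [mul_apply]
    exact h
  have h : C = Ring.inverse (A.leadingBlocks a) * I := by
    rw [← key, ← Matrix.mul_assoc, Ring.inverse_mul_cancel _ (hA a), Matrix.one_mul]
  have h' : C ⟨x, hle⟩ j = (Ring.inverse (A.leadingBlocks a) * I) ⟨x, hle⟩ j := by rw [h]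
  rw [mul_apply, Finset.sum_eq_single ⟨⟨a, j⟩, le_rfl⟩] at h'
  · rw [upperFactor_of_le _ hle]
    simpa [C, I] using h'.symm
  · intro z _ hz
    have hz' : z.1 ≠ ⟨a, j⟩ := fun h => hz (Subtype.ext h)
    simp [I, one_apply_ne hz']
  · simp

omit [∀ a, Fintype (m a)] in
theorem IsBlockUnitriangular.blockDiag'_eq_one {E : Matrix (Σ a, m a) (Σ a, m a) R}
    (hE : E.IsBlockUnitriangular fun x => x.1) (a : Fin n) : blockDiag' E a = 1 := by
  ext i j
  rw [blockDiag'_apply, hE ⟨a, i⟩ ⟨a, j⟩ le_rfl]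
  simp [one_apply]

omit [∀ a, DecidableEq (m a)] in
theorem blockDiag'_mul_blockDiagonal' (M : Matrix (Σ a, m a) (Σ a, m a) R)
    (D : ∀ a, Matrix (m a) (m a) R) (a : Fin n) :
    blockDiag' (M * blockDiagonal' D) a = blockDiag' M a * D a := by
  ext i j
  rw [blockDiag'_apply, mul_apply, mul_apply, Fintype.sum_sigma, Finset.sum_eq_single a]
  · simp [blockDiag'_apply, blockDiagonal'_apply_eq]
  · intro b _ hb
    exact Finset.sum_eq_zero fun k _ => by rw [blockDiagonal'_apply_ne _ _ _ hb, mul_zero]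
  · simp

omit [∀ a, DecidableEq (m a)] in
theorem blockDiag'_blockDiagonal'_mul (M : Matrix (Σ a, m a) (Σ a, m a) R)
    (D : ∀ a, Matrix (m a) (m a) R) (a : Fin n) :
    blockDiag' (blockDiagonal' D * M) a = D a * blockDiag' M a := by
  ext i j
  rw [blockDiag'_apply, mul_apply, mul_apply, Fintype.sum_sigma, Finset.sum_eq_single a]
  · simp [blockDiag'_apply, blockDiagonal'_apply_eq]
  · intro b _ hb
    exact Finset.sum_eq_zero fun k _ => by rw [blockDiagonal'_apply_ne _ _ _ hb.symm, zero_mul]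
  · simp

omit [∀ a, DecidableEq (m a)] in
theorem mul_blockDiagonal'_apply_eq_zero {M : Matrix (Σ a, m a) (Σ a, m a) R}
    (hM : ∀ x y, y.1 < x.1 → M x y = 0) (D : ∀ a, Matrix (m a) (m a) R) (x y : Σ a, m a)
    (h : y.1 < x.1) : (M * blockDiagonal' D) x y = 0 := by
  rw [mul_apply]
  refine Finset.sum_eq_zero fun z _ => ?_
  rcases eq_or_ne z.1 y.1 with hz | hz
  · rw [hM x z (hz ▸ h), zero_mul]
  · obtain ⟨z, _⟩ := z
    obtain ⟨y, _⟩ := y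
    rw [blockDiagonal'_apply_ne _ _ _ hz, mul_zero]

theorem blockDiagonal'_mul_blockDiagonal'_eq_one {D D' : ∀ a, Matrix (m a) (m a) R}
    (h : ∀ a, D a * D' a = 1) : blockDiagonal' D * blockDiagonal' D' = 1 := by
  rw [← blockDiagonal'_mul, show (fun a => D a * D' a) = 1 from funext h, blockDiagonal'_one]

omit [∀ a, Fintype (m a)] in
theorem isBlockUnitriangular_fst {E : Matrix (Σ a, m a) (Σ a, m a) R}
    (h0 : ∀ x y, y.1 < x.1 → E x y = 0) (h1 : ∀ a, blockDiag' E a = 1) :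
    E.IsBlockUnitriangular fun x => x.1 := by
  rintro ⟨a, i⟩ ⟨b, j⟩ h
  rcases (Fin.le_def.2 h : b ≤ a).lt_or_eq with h | rfl
  · rw [h0 _ _ h, one_apply_ne]
    intro he
    exact h.ne (congrArg Sigma.fst he).symm
  · rw [← blockDiag'_apply E, h1]
    simp [one_apply]

omit [∀ a, Fintype (m a)] in
theorem isBlockUnitriangular_sub_fst {F : Matrix (Σ a, m a) (Σ a, m a) R}
    (h0 : ∀ x y, x.1 < y.1 → F x y = 0) (h1 : ∀ a, blockDiag' F a = 1) :
    F.IsBlockUnitriangular fun x => n - x.1 := by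
  rintro ⟨a, i⟩ ⟨b, j⟩ h
  have h' : a ≤ b := by
    simp only at h
    rw [Fin.le_def]
    omega
  rcases h'.lt_or_eq with h | rfl
  · rw [h0 _ _ h, one_apply_ne]
    intro he
    exact h.ne (congrArg Sigma.fst he)
  · rw [← blockDiag'_apply F, h1]
    simp [one_apply]

/-- Existence of the block Gauss decomposition. -/
theorem exists_gauss {A : Matrix (Σ a, m a) (Σ a, m a) R}
    (hA : ∀ a, IsUnit (A.leadingBlocks a)) (hV : ∀ a, IsUnit (blockDiag' A.upperFactor a)) :
    ∃ (F : Matrix (Σ a, m a) (Σ a, m a) R) (D : ∀ a, Matrix (m a) (m a) R)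
      (E : Matrix (Σ a, m a) (Σ a, m a) R), (F.IsBlockUnitriangular fun x => n - x.1) ∧
        (E.IsBlockUnitriangular fun x => x.1) ∧ A = F * blockDiagonal' D * E := by
  -- With `V` the upper factor and `D` the inverse of its block diagonal, `V * D` is upper
  -- unitriangular. Taking `E` as its inverse gives `A = (A * V) * D * E`.
  have hL : (A.upperFactor * blockDiagonal' fun a =>
      Ring.inverse (blockDiag' A.upperFactor a)).IsBlockUnitriangular fun x => x.1 := by
    refine isBlockUnitriangular_fst (fun x y h => ?_) fun a => ?_
    · exact mul_blockDiagonal'_apply_eq_zero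
        (fun x y h => upperFactor_of_not_le _ (not_le.2 h)) _ x y h
    · rw [blockDiag'_mul_blockDiagonal', Ring.mul_inverse_cancel _ (hV a)]
  obtain ⟨E, hE, -⟩ := isUnit_iff_exists.1 hL.isUnit
  refine ⟨A * A.upperFactor, fun a => Ring.inverse (blockDiag' A.upperFactor a), E,
    isBlockUnitriangular_mul_upperFactor hA, hL.of_mul ?_, ?_⟩
  · rw [hE]
    exact IsBlockUnitriangular.one _
  · rw [Matrix.mul_assoc, Matrix.mul_assoc, ← Matrix.mul_assoc (A.upperFactor), hE,
      Matrix.mul_one]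

/-- The factors of a block Gauss decomposition are determined by the inverses of the leading
block submatrices. -/
theorem gauss_eq {A F E : Matrix (Σ a, m a) (Σ a, m a) R} {D : ∀ a, Matrix (m a) (m a) R}
    (hunit : IsUnit A) (hA : ∀ a, IsUnit (A.leadingBlocks a))
    (hF : F.IsBlockUnitriangular fun x => n - x.1) (hE : E.IsBlockUnitriangular fun x => x.1)
    (h : A = F * blockDiagonal' D * E) :
    (∀ a, D a * blockDiag' A.upperFactor a = 1 ∧ blockDiag' A.upperFactor a * D a = 1) ∧
      F = A * A.upperFactor ∧ A.upperFactor * blockDiagonal' D * E = 1 ∧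
      E * (A.upperFactor * blockDiagonal' D) = 1 := by
  obtain ⟨K, hFK, hKF⟩ := isUnit_iff_exists.1 hF.isUnit
  obtain ⟨L, hEL, hLE⟩ := isUnit_iff_exists.1 hE.isUnit
  have hL : L.IsBlockUnitriangular fun x => x.1 := hE.of_mul (hEL ▸ IsBlockUnitriangular.one _)
  have hD : blockDiagonal' D = K * A * L := by
    rw [h, Matrix.mul_assoc F, ← Matrix.mul_assoc K, hKF, Matrix.one_mul, Matrix.mul_assoc, hEL,
      Matrix.mul_one]
  have hDunit : IsUnit (blockDiagonal' D) := by
    rw [hD]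
    exact ((isUnit_iff_exists.2 ⟨F, hKF, hFK⟩).mul hunit).mul
      (isUnit_iff_exists.2 ⟨E, hLE, hEL⟩)
  -- `Q` is not known to be block diagonal, but its diagonal blocks already invert the `D a`, which
  -- is all that is needed.
  obtain ⟨Q, hDQ, hQD⟩ := isUnit_iff_exists.1 hDunit
  have hDq (a) : D a * blockDiag' Q a = 1 := by
    rw [← blockDiag'_blockDiagonal'_mul, hDQ, blockDiag'_one]
    rfl
  have hqD (a) : blockDiag' Q a * D a = 1 := by
    rw [← blockDiag'_mul_blockDiagonal', hQD, blockDiag'_one]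
    rfl
  have hbd : blockDiagonal' D * blockDiagonal' (blockDiag' Q) = 1 :=
    blockDiagonal'_mul_blockDiagonal'_eq_one hDq
  have hbd' : blockDiagonal' (blockDiag' Q) * blockDiagonal' D = 1 :=
    blockDiagonal'_mul_blockDiagonal'_eq_one hqD
  have hAV : A * (L * blockDiagonal' (blockDiag' Q)) = F := by
    rw [h, Matrix.mul_assoc _ E, ← Matrix.mul_assoc E, hEL, Matrix.one_mul, Matrix.mul_assoc, hbd,
      Matrix.mul_one]
  have hV : A.upperFactor = L * blockDiagonal' (blockDiag' Q) := by
    refine upperFactor_eq hA (mul_blockDiagonal'_apply_eq_zero (fun x y h => ?_) _)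
      (hAV ▸ hF)
    rw [hL x y (Fin.le_def.1 h.le), one_apply_ne]
    rintro rfl
    exact h.false
  refine ⟨fun a => ?_, ?_, ?_, ?_⟩
  · rw [hV, blockDiag'_mul_blockDiagonal', hL.blockDiag'_eq_one, Matrix.one_mul]
    exact ⟨hDq a, hqD a⟩
  · rw [hV, hAV]
  · rw [hV, Matrix.mul_assoc L, hbd', Matrix.mul_one, hLE]
  · rw [hV, Matrix.mul_assoc L, hbd', Matrix.mul_one, hEL]

end Matrix

end Gauss

/-! ### The `RTT` relation and inversion. -/

section RTT

variable {ι κ k S : Type*} [CommRing k] [Ring S] [Algebra k S]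

/-- The matrices `A` and `B` satisfy the `RTT` relation with parities `p`, where `z` plays the
role of `u - v` and `w` that of the structure constant. -/
def RTT (p : ι → ℕ) (z w : k) (A B : Matrix ι ι S) : Prop :=
  ∀ i j h l, z • (A i j * B h l
      - (-1 : k) ^ ((p i + p j) * (p h + p l)) • (B h l * A i j)) =
    ((-1 : k) ^ (p i * p j + p i * p h + p j * p h) * w) • (A h j * B i l - B h j * A i l)

theorem RTT.submatrix {p : ι → ℕ} {z w : k} {A B : Matrix ι ι S} (h : RTT p z w A B)
    (f : κ → ι) : RTT (p ∘ f) z w (A.submatrix f f) (B.submatrix f f) :=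
  fun i j h' l => h (f i) (f j) (f h') (f l)

/-- The diagonal matrix of the signs `(-1) ^ (d * p i)`. -/
def Matrix.signDiagonal [DecidableEq ι] (k S : Type*) [CommRing k] [Ring S] [Algebra k S]
    (p : ι → ℕ) (d : ℕ) : Matrix ι ι S :=
  Matrix.diagonal fun i => algebraMap k S ((-1) ^ (d * p i))

variable [Fintype ι] [DecidableEq ι]

theorem Matrix.signDiagonal_mul_apply (p : ι → ℕ) (d : ℕ) (A : Matrix ι ι S) (i j : ι) :
    (signDiagonal k S p d * A) i j = (-1 : k) ^ (d * p i) • A i j := by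
  rw [signDiagonal, Matrix.diagonal_mul, Algebra.smul_def]

theorem Matrix.mul_signDiagonal_apply (p : ι → ℕ) (d : ℕ) (A : Matrix ι ι S) (i j : ι) :
    (A * signDiagonal k S p d) i j = (-1 : k) ^ (d * p j) • A i j := by
  rw [signDiagonal, Matrix.mul_diagonal, Algebra.smul_def, Algebra.commutes]

theorem neg_one_pow_mul_self (n : ℕ) : (-1 : k) ^ n * (-1) ^ n = 1 := by
  rw [← mul_pow]
  simp

theorem Matrix.signDiagonal_mul_self (p : ι → ℕ) (d : ℕ) :
    signDiagonal k S p d * signDiagonal k S p d = 1 := by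
  rw [signDiagonal, Matrix.diagonal_mul_diagonal]
  simp only [← map_mul, neg_one_pow_mul_self, map_one, Matrix.diagonal_one]

theorem Matrix.diagonal_mul_signDiagonal (p : ι → ℕ) (d : ℕ) (a : S) :
    Matrix.diagonal (fun _ => a) * signDiagonal k S p d =
      signDiagonal k S p d * Matrix.diagonal fun _ => a := by
  simp only [signDiagonal, Matrix.diagonal_mul_diagonal, Algebra.commutes]

variable {p : ι → ℕ} {z w : k} {A B A' B' : Matrix ι ι S}

/-- The relation between the entries of `A` and those of the inverse of `B`. -/
theorem RTT.mul_inverse (h : RTT p z w A B) (hB : B * B' = 1) (hB' : B' * B = 1) (i j x l : ι) :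
    z • (A i j * B' x l - (-1 : k) ^ ((p i + p j) * (p x + p l)) • (B' x l * A i j)) =
      ((-1 : k) ^ (p i * p j + p i * p x + p j * p x) * w) •
        ((if j = x then (A * B') i l else 0) - if i = l then (B' * A) x j else 0) := by
  -- For fixed `i` and `j` the relation becomes one matrix identity in the indices of `B`:
  -- conjugation by `P` produces the supercommutator sign, and the matrix unit `e` encodes the
  -- exchange of indices.
  set P : Matrix ι ι S := Matrix.signDiagonal k S p (p i + p j) with hP
  set Δ : Matrix ι ι S := Matrix.diagonal fun _ => A i j with hΔ
  set e : Matrix ι ι S := Matrix.single j i 1 with he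
  have hPP : P * P = 1 := Matrix.signDiagonal_mul_self _ _
  have hmat : z • (Δ * B - P * B * P * Δ) =
      ((-1 : k) ^ (p i * p j) * w) • (P * (A * e * B - B * e * A)) := by
    ext x l
    have := h i j x l
    simp only [Matrix.smul_apply, Matrix.sub_apply, hP, hΔ, Matrix.diagonal_mul,
      Matrix.mul_diagonal, Matrix.signDiagonal_mul_apply, Matrix.mul_signDiagonal_apply,
      smul_smul, ← pow_add, smul_mul_assoc]
    have h1 : (A * e * B) x l = A x j * B i l := by
      rw [Matrix.mul_apply, Finset.sum_eq_single i] <;> simp +contextual [he, Matrix.mul_single_apply_of_ne]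
    have h2 : (B * e * A) x l = B x j * A i l := by
      rw [Matrix.mul_apply, Finset.sum_eq_single i] <;> simp +contextual [he, Matrix.mul_single_apply_of_ne]
    rw [h1, h2]
    convert this using 2
    · congr 2
      ring
    · ring
  -- `P * B' * P` inverts the sign-twisted `P * B * P`, so this multiplication replaces both
  -- occurrences of `B` on the left by `B'`.
  have h2 := congrArg (fun M => P * B' * P * M * B') hmat
  have hl : P * B' * P * (z • (Δ * B - P * B * P * Δ)) * B' =
      z • (P * B' * P * Δ - Δ * B') := by
    rw [mul_smul_comm, smul_mul_assoc]
    congr 1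
    calc _ = P * B' * P * Δ * (B * B') - P * (B' * (P * P) * B) * P * Δ * B' := by noncomm_ring
      _ = _ := by rw [hB, hPP, mul_one, mul_one, hB', mul_one, hPP, one_mul]
  have hr : P * B' * P * (((-1 : k) ^ (p i * p j) * w) • (P * (A * e * B - B * e * A))) * B' =
      ((-1 : k) ^ (p i * p j) * w) • (P * (B' * A * e - e * (A * B'))) := by
    rw [mul_smul_comm, smul_mul_assoc]
    congr 1
    calc _ = P * B' * (P * P) * A * e * (B * B') - P * (B' * (P * P) * B) * e * A * B' := by
            noncomm_ring
      _ = _ := by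
            rw [hB, hPP, mul_one, mul_one, mul_one, hB']
            noncomm_ring
  beta_reduce at h2
  rw [hl, hr] at h2
  have h3 := congrFun (congrFun h2 x) l
  have h1 : (B' * A * e) x l = if i = l then (B' * A) x j else 0 := by
    split_ifs with hil
    · subst hil; simp [he]
    · simp [he, Matrix.mul_single_apply_of_ne, Ne.symm hil]
  have h4 : (e * (A * B')) x l = if j = x then (A * B') i l else 0 := by
    split_ifs with hil
    · subst hil; simp [he]
    · simp [he, Matrix.single_mul_apply_of_ne, Ne.symm hil]
  simp only [Matrix.smul_apply, Matrix.sub_apply, hP, hΔ, Matrix.diagonal_mul,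
      Matrix.mul_diagonal, Matrix.signDiagonal_mul_apply, Matrix.mul_signDiagonal_apply,
      smul_smul, ← pow_add, smul_mul_assoc] at h3
  rw [h1, h4, ← neg_inj, ← smul_neg, ← smul_neg, neg_sub, neg_sub] at h3
  convert h3 using 2
  · congr 2
    ring
  · ring

/-- If `A` and `B` satisfy the `RTT` relation, so do `B⁻¹` and `A⁻¹`. -/
theorem RTT.inverse (h : RTT p z w A B) (hA : A * A' = 1) (hA' : A' * A = 1) (hB : B * B' = 1)
    (hB' : B' * B = 1) : RTT p z w B' A' := by
  intro x l i j
  set P : Matrix ι ι S := Matrix.signDiagonal k S p (p x + p l) with hP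
  set Δ : Matrix ι ι S := Matrix.diagonal fun _ => B' x l with hΔ
  set e : Matrix ι ι S := Matrix.single l x 1 with he
  have hPP : P * P = 1 := Matrix.signDiagonal_mul_self _ _
  have hΔP : Δ * P = P * Δ := Matrix.diagonal_mul_signDiagonal _ _ _
  -- Now the entry of `B'` is fixed and the mixed relation is read as a matrix identity in the
  -- indices of `A`.
  have hmat : z • (A * Δ - Δ * P * A * P) =
      w • ((-1 : k) ^ p x • (A * B' * e) - (-1 : k) ^ (p l * p x) • (e * (B' * A) * P)) := by
    ext i j
    have h0 := h.mul_inverse hB hB' i j x l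
    have h1 : (A * B' * e) i j = if j = x then (A * B') i l else 0 := by
      split_ifs with hjx
      · subst hjx; simp [he]
      · simp [he, Matrix.mul_single_apply_of_ne, hjx]
    have h2 : (e * (B' * A)) i j = if i = l then (B' * A) x j else 0 := by
      split_ifs with hil
      · subst hil; simp [he]
      · simp [he, Matrix.single_mul_apply_of_ne, hil]
    have h3 : (Δ * P * A * P) i j =
        (-1 : k) ^ ((p i + p j) * (p x + p l)) • (B' x l * A i j) := by
      rw [hP, Matrix.mul_signDiagonal_apply, Matrix.mul_assoc, hΔ, Matrix.diagonal_mul,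
        Matrix.signDiagonal_mul_apply, mul_smul_comm, smul_smul, ← pow_add]
      congr 2
      ring
    rw [Matrix.smul_apply, Matrix.sub_apply, h3, hΔ, Matrix.mul_diagonal, h0, Matrix.smul_apply,
      Matrix.sub_apply, Matrix.smul_apply, Matrix.smul_apply, h1, hP,
      Matrix.mul_signDiagonal_apply, h2, mul_comm _ w, mul_smul, smul_sub, smul_smul _ _ (ite _ _ _),
      ← pow_add]
    congr 2
    · split_ifs with hjx
      · subst hjx
        congr 1
        exact neg_one_pow_congr (by simp only [Nat.even_add, Nat.even_mul]; tauto)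
      · simp
    · split_ifs with hil
      · subst hil
        congr 1
        exact neg_one_pow_congr (by simp only [Nat.even_add, Nat.even_mul]; tauto)
      · simp
  -- This inverts `A` on the left and its sign twist `P * A * P` on the right.
  have h2 := congrArg (fun M => A' * M * (P * A' * P)) hmat
  have hl : A' * (z • (A * Δ - Δ * P * A * P)) * (P * A' * P) =
      z • (P * Δ * A' * P - A' * Δ) := by
    rw [mul_smul_comm, smul_mul_assoc]
    congr 1
    calc _ = A' * A * (Δ * P) * A' * P - A' * Δ * (P * (A * (P * P) * A') * P) := by noncomm_ring
      _ = _ := by rw [hA', hPP, mul_one, hA, mul_one, hPP, mul_one, one_mul, hΔP]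
  have hr : A' * (w • ((-1 : k) ^ p x • (A * B' * e) -
      (-1 : k) ^ (p l * p x) • (e * (B' * A) * P))) * (P * A' * P) =
      w • ((-1 : k) ^ p x • (B' * e * (P * A' * P)) -
        (-1 : k) ^ (p l * p x) • (A' * e * (B' * P))) := by
    rw [mul_smul_comm, smul_mul_assoc, mul_sub, sub_mul, mul_smul_comm, smul_mul_assoc,
      mul_smul_comm, smul_mul_assoc]
    congr 3
    · calc _ = A' * A * B' * e * (P * A' * P) := by noncomm_ring
        _ = _ := by rw [hA', one_mul]
    · calc _ = A' * e * B' * (A * (P * P) * A') * P := by noncomm_ring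
        _ = _ := by rw [hPP, mul_one, hA, mul_one, mul_assoc]
  beta_reduce at h2
  rw [hl, hr] at h2
  have h3 := congrFun (congrFun h2 i) j
  have e1 : (B' * e * (P * A' * P)) i j =
      (-1 : k) ^ ((p x + p l) * p x + (p x + p l) * p j) • (B' i l * A' x j) := by
    rw [Matrix.mul_apply, Finset.sum_eq_single x]
    · rw [hP, Matrix.mul_signDiagonal_apply, Matrix.signDiagonal_mul_apply, mul_smul_comm,
        mul_smul_comm, smul_smul, ← pow_add, add_comm]
      simp [he]
    · intro y _ hy
      simp [he, Matrix.mul_single_apply_of_ne, hy]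
    · simp
  have e2 : (A' * e * (B' * P)) i j =
      (-1 : k) ^ ((p x + p l) * p j) • (A' i l * B' x j) := by
    rw [Matrix.mul_apply, Finset.sum_eq_single x]
    · rw [hP, Matrix.mul_signDiagonal_apply, mul_smul_comm]
      simp [he]
    · intro y _ hy
      simp [he, Matrix.mul_single_apply_of_ne, hy]
    · simp
  have e3 : (P * Δ * A' * P - A' * Δ) i j =
      (-1 : k) ^ ((p x + p l) * (p i + p j)) • (B' x l * A' i j) - A' i j * B' x l := by
    rw [Matrix.sub_apply, hP, Matrix.mul_signDiagonal_apply, Matrix.mul_assoc,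
      Matrix.signDiagonal_mul_apply, hΔ, Matrix.diagonal_mul, Matrix.mul_diagonal, smul_smul,
      ← pow_add, mul_add, add_comm]
  rw [Matrix.smul_apply, e3, Matrix.smul_apply, Matrix.sub_apply, Matrix.smul_apply,
    Matrix.smul_apply, e1, e2, smul_smul ((-1 : k) ^ p x), smul_smul ((-1 : k) ^ (p l * p x)),
    ← pow_add, ← pow_add] at h3
  -- `h3` carries the sign on the other term of the supercommutator; multiplying by `ε`, whose
  -- square is 1, moves it.
  set ε : k := (-1) ^ ((p x + p l) * (p i + p j)) with hε
  calc z • (B' x l * A' i j - ε • (A' i j * B' x l))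
      = ε • z • (ε • (B' x l * A' i j) - A' i j * B' x l) := by
        rw [smul_comm ε z, smul_sub ε, smul_smul ε ε, neg_one_pow_mul_self, one_smul]
    _ = w • ((ε * (-1 : k) ^ (p x + ((p x + p l) * p x + (p x + p l) * p j))) •
          (B' i l * A' x j) -
          (ε * (-1 : k) ^ (p l * p x + (p x + p l) * p j)) • (A' i l * B' x j)) := by
        rw [h3, smul_comm ε w, smul_sub ε, smul_smul, smul_smul]
    _ = _ := by
        rw [mul_comm _ w, mul_smul w, smul_sub ((-1 : k) ^ (p x * p l + p x * p i + p l * p i)), hε,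
          ← pow_add, ← pow_add]
        congr 3
        · exact neg_one_pow_congr (by
          simp only [Nat.even_add, Nat.even_mul]
          by_cases Even (p x) <;> by_cases Even (p l) <;> by_cases Even (p i) <;>
            by_cases Even (p j) <;> simp [*])
        · exact neg_one_pow_congr (by
          simp only [Nat.even_add, Nat.even_mul]
          by_cases Even (p x) <;> by_cases Even (p l) <;> by_cases Even (p i) <;>
            by_cases Even (p j) <;> simp [*])

end RTT

/-! ### Power series in two variables and comparison of coefficients. -/

noncomputable section TwoVariables

open PowerSeries

variable {R : Type*} [Ring R]

/-- Signs occur as scalars in `ℂ`, in `ℤ` and in the centre of the power series ring; integers are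
the common form. -/
theorem neg_one_pow_smul_eq_zsmul {k M : Type*} [Ring k] [AddCommGroup M] [Module k M] (n : ℕ)
    (x : M) : (-1 : k) ^ n • x = (-1 : ℤ) ^ n • x := by
  rcases n.even_or_odd with h | h <;> simp [h.neg_one_pow]

/-- Solution of the recursion `f (r + 1) s - f r (s + 1) = g r s` for skew-symmetric `g`. -/
theorem sub_succ_eq_iff {M : Type*} [AddCommGroup M] {f g : ℕ → ℕ → M}
    (hg : ∀ r s, g r s = -g s r) (hg0 : ∀ r, g r r = 0) (hf : ∀ s, f 0 s = 0) :
    (∀ r s, f (r + 1) s - f r (s + 1) = g r s) ↔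
      ∀ r s, f r s = ∑ q ∈ Finset.range (min r s), g q (r + s - 1 - q) := by
  -- Both sums run along the antidiagonal of total `r + s` and differ by one term: `g r s` on the
  -- left if `r < s`, `g s r = -g r s` on the right if `r > s`, and none if `r = s`, where `g r r =
  -- 0`.
  have key : ∀ r s, ∑ q ∈ Finset.range (min (r + 1) s), g q (r + 1 + s - 1 - q) =
      g r s + ∑ q ∈ Finset.range (min r (s + 1)), g q (r + (s + 1) - 1 - q) := by
    intro r s
    have e : r + 1 + s - 1 = r + s := by omega
    have e' : r + (s + 1) - 1 = r + s := by omega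
    rw [e, e']
    rcases lt_trichotomy r s with h | rfl | h
    · rw [min_eq_left (by omega : r + 1 ≤ s), min_eq_left (by omega : r ≤ s + 1),
        Finset.sum_range_succ, add_comm, Nat.add_sub_cancel_left]
    · rw [min_eq_right (by omega : r ≤ r + 1), min_eq_left (by omega : r ≤ r + 1), hg0, zero_add]
    · rw [min_eq_right (by omega : s ≤ r + 1), min_eq_right (by omega : s + 1 ≤ r),
        Finset.sum_range_succ, Nat.add_sub_cancel, hg r s]
      abel
  constructor
  · intro h r
    induction r with
    | zero => simp [hf]
    | succ r ih => intro s; rw [key, ← ih, ← h r s, sub_add_cancel]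
  · intro h r s
    rw [h, h, key, add_sub_cancel_right]

/-- Comparison of coefficients in `(v⁻¹ - u⁻¹) f = u⁻¹ v⁻¹ g`. -/
theorem PowerSeries.sub_mul_eq_iff (f g : R⟦X⟧⟦X⟧) :
    ((X : R⟦X⟧⟦X⟧) - C X) * f = (C X * X) * g ↔
      (∀ s, coeff 0 (coeff s f) = 0) ∧ (∀ r, coeff r (coeff 0 f) = 0) ∧
        ∀ r s, coeff (r + 1) (coeff s f) - coeff r (coeff (s + 1) f) = coeff r (coeff s g) := by
  constructor
  · intro h
    refine ⟨fun s => ?_, fun r => ?_, fun r s => ?_⟩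
    · simpa [sub_mul, mul_assoc, coeff_succ_X_mul] using
        congrArg (fun e => coeff 0 (coeff (s + 1) e)) h
    · simpa [sub_mul, mul_assoc, coeff_succ_X_mul] using
        congrArg (fun e => coeff (r + 1) (coeff 0 e)) h
    · simpa [sub_mul, mul_assoc, coeff_succ_X_mul] using
        congrArg (fun e => coeff (r + 1) (coeff (s + 1) e)) h
  · rintro ⟨h1, h2, h3⟩
    ext s r
    rcases r with _ | r <;> rcases s with _ | s
    · simp [sub_mul, mul_assoc]
    · simpa [sub_mul, mul_assoc, coeff_succ_X_mul] using h1 s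
    · simpa [sub_mul, mul_assoc, coeff_succ_X_mul] using h2 r
    · simpa [sub_mul, mul_assoc, coeff_succ_X_mul] using h3 r s

/-- The coefficients are constant along antidiagonals and vanish on the boundary, so `v⁻¹ - u⁻¹` can
be cancelled. -/
theorem PowerSeries.eq_zero_of_sub_mul_eq_zero {f : R⟦X⟧⟦X⟧}
    (h : ((X : R⟦X⟧⟦X⟧) - C X) * f = 0) : f = 0 := by
  obtain ⟨h1, -, h3⟩ := (PowerSeries.sub_mul_eq_iff f 0).1 (by rw [h, mul_zero])
  ext s r
  induction r generalizing s with
  | zero => simpa using h1 s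
  | succ r ih =>
    have := h3 r s
    rw [ih] at this
    simpa using this

theorem PowerSeries.coeff_C_mul_map_C (a b : R⟦X⟧) (r s : ℕ) :
    coeff r (coeff s (C a * map C b)) = coeff r a * coeff s b := by
  simp

theorem PowerSeries.coeff_map_C_mul_C (a b : R⟦X⟧) (r s : ℕ) :
    coeff r (coeff s (map C b * C a)) = coeff s b * coeff r a := by
  simp

theorem PowerSeries.commute_X_sub_C_X (f : R⟦X⟧⟦X⟧) : Commute ((X : R⟦X⟧⟦X⟧) - C X) f := by
  refine (commute_X f).symm.sub_left ?_
  ext s r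
  simp [(commute_X (coeff s f)).eq]

theorem PowerSeries.commute_C_X_mul_X (f : R⟦X⟧⟦X⟧) : Commute (C X * X : R⟦X⟧⟦X⟧) f := by
  refine Commute.mul_left ?_ (commute_X f).symm
  ext s r
  simp [(commute_X (coeff s f)).eq]

/-- The central element `v⁻¹ - u⁻¹` of the ring of power series in `u⁻¹` and `v⁻¹`. -/
def PowerSeries.centralDiff (R : Type*) [Ring R] : Subring.center (R⟦X⟧⟦X⟧) :=
  ⟨X - C X, Subring.mem_center_iff.2 fun f => (commute_X_sub_C_X f).eq.symm⟩

/-- The central element `u⁻¹ v⁻¹` of the ring of power series in `u⁻¹` and `v⁻¹`. -/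
def PowerSeries.centralProd (R : Type*) [Ring R] : Subring.center (R⟦X⟧⟦X⟧) :=
  ⟨C X * X, Subring.mem_center_iff.2 fun f => (commute_C_X_mul_X f).eq.symm⟩

end TwoVariables

/-! ### Matrices satisfying the super Yangian relations. -/

section YangianMatrix

open PowerSeries

variable {ι κ R : Type*} [Ring R]

/-- The coefficients of the entries of `A` satisfy the defining relations of the super Yangian
with parities `p`. -/
def IsYangianMatrix (p : ι → ℕ) (A : Matrix ι ι R⟦X⟧) : Prop :=
  ∀ i j h l r s, coeff r (A i j) * coeff s (A h l)
      - (-1 : ℤ) ^ ((p i + p j) * (p h + p l)) • (coeff s (A h l) * coeff r (A i j)) =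
    (-1 : ℤ) ^ (p i * p j + p i * p h + p j * p h) • ∑ q ∈ Finset.range (min r s),
      (coeff q (A h j) * coeff (r + s - 1 - q) (A i l) -
        coeff (r + s - 1 - q) (A h j) * coeff q (A i l))

variable [DecidableEq ι]

/-- The two copies of `A` are `A(u)` and `A(v)`, with `u⁻¹` the inner and `v⁻¹` the outer variable;
dividing `v⁻¹ - u⁻¹` by `u⁻¹ v⁻¹` formally gives `u - v`. Comparing coefficients gives a recursion
whose solution is the sum in the defining relations. -/
theorem rtt_iff_isYangianMatrix {p : ι → ℕ} {A : Matrix ι ι R⟦X⟧}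
    (hA : A.map constantCoeff = 1) :
    RTT p (centralDiff R) (centralProd R) (A.map C) (A.map (PowerSeries.map C)) ↔
      IsYangianMatrix p A := by
  refine forall_congr' fun i => forall_congr' fun j => forall_congr' fun h =>
    forall_congr' fun l => ?_
  have h0 (i j : ι) : coeff 0 (A i j) = if i = j then 1 else 0 := by
    have := congrFun (congrFun hA i) j
    rwa [Matrix.map_apply, ← coeff_zero_eq_constantCoeff_apply, Matrix.one_apply] at this
  set f : ℕ → ℕ → R := fun r s => coeff r (A i j) * coeff s (A h l)
      - (-1 : ℤ) ^ ((p i + p j) * (p h + p l)) • (coeff s (A h l) * coeff r (A i j)) with hf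
  set g : ℕ → ℕ → R := fun r s => (-1 : ℤ) ^ (p i * p j + p i * p h + p j * p h) •
      (coeff r (A h j) * coeff s (A i l) - coeff s (A h j) * coeff r (A i l)) with hg
  -- The boundary values vanish because the constant term is 1: its nonzero entries are diagonal,
  -- hence even and central.
  have hf1 (s) : f 0 s = 0 := by
    simp only [hf, h0]
    split_ifs with hij
    · subst hij
      rw [← two_mul, mul_assoc, pow_mul]
      simp
    · simp
  have hf2 (r) : f r 0 = 0 := by
    simp only [hf, h0]
    split_ifs with hij
    · subst hij
      rw [← two_mul, mul_comm, mul_assoc, pow_mul]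
      simp
    · simp
  have hiff := sub_succ_eq_iff (f := f) (g := g)
    (fun r s => by rw [hg]; beta_reduce; rw [← smul_neg, neg_sub])
    (fun r => by rw [hg]; beta_reduce; rw [sub_self, smul_zero]) hf1
  set f' : R⟦X⟧⟦X⟧ := C (A i j) * PowerSeries.map C (A h l) -
    (-1 : Subring.center (R⟦X⟧⟦X⟧)) ^ ((p i + p j) * (p h + p l)) •
      (PowerSeries.map C (A h l) * C (A i j)) with hf'
  set g' : R⟦X⟧⟦X⟧ := (-1 : Subring.center (R⟦X⟧⟦X⟧)) ^ (p i * p j + p i * p h + p j * p h) •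
    (C (A h j) * PowerSeries.map C (A i l) - PowerSeries.map C (A h j) * C (A i l)) with hg'
  have hF (r s) : coeff r (coeff s f') = f r s := by
    rw [hf', neg_one_pow_smul_eq_zsmul, map_sub, map_sub, map_zsmul, map_zsmul, coeff_C_mul_map_C,
      coeff_map_C_mul_C]
  have hG (r s) : coeff r (coeff s g') = g r s := by
    rw [hg', neg_one_pow_smul_eq_zsmul, map_zsmul, map_zsmul, map_sub, map_sub, coeff_C_mul_map_C,
      coeff_map_C_mul_C]
  have key := PowerSeries.sub_mul_eq_iff f' g'
  simp only [hF, hG, hf1, hf2, implies_true, true_and] at key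
  rw [hiff] at key
  simp only [hg, ← Finset.smul_sum] at key
  rw [mul_comm _ (centralProd R), mul_smul]
  exact key

variable [Fintype ι]

theorem Matrix.map_mul_map_eq_one {S T : Type*} [Semiring S] [Semiring T] (φ : S →+* T)
    {A B : Matrix ι ι S} (h : A * B = 1) : A.map φ * B.map φ = 1 := by
  rw [← Matrix.map_mul, h, Matrix.map_one _ (map_zero _) (map_one _)]

/-- The inverse of a diagonal block of the inverse of a matrix satisfying the super Yangian
relations satisfies them too. -/
theorem IsYangianMatrix.of_inverse_block [Fintype κ] [DecidableEq κ] {p : ι → ℕ}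
    {A B : Matrix ι ι R⟦X⟧} (hA : IsYangianMatrix p A) (h0 : A.map constantCoeff = 1)
    (hAB : A * B = 1) (hBA : B * A = 1) {f : κ → ι} (hf : Function.Injective f)
    {D : Matrix κ κ R⟦X⟧} (hD : D * B.submatrix f f = 1) (hD' : B.submatrix f f * D = 1) :
    IsYangianMatrix (p ∘ f) D := by
  have hB0 := Matrix.map_constantCoeff_eq_one_of_mul_eq_one h0 hAB
  have hBf : (B.submatrix f f).map constantCoeff = 1 := by
    rw [← Matrix.submatrix_map, hB0, Matrix.submatrix_one _ hf]
  have hD0 := Matrix.map_constantCoeff_eq_one_of_mul_eq_one hBf hD'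
  have e1 := Matrix.map_mul_map_eq_one (C (R := R⟦X⟧)) hAB
  have e2 := Matrix.map_mul_map_eq_one (C (R := R⟦X⟧)) hBA
  have e3 := Matrix.map_mul_map_eq_one (PowerSeries.map (C (R := R))) hAB
  have e4 := Matrix.map_mul_map_eq_one (PowerSeries.map (C (R := R))) hBA
  have e0 := (rtt_iff_isYangianMatrix h0).2 hA
  have h1 := e0.inverse e1 e2 e3 e4
  -- In `h1` the inverse in `v` comes first; the second inversion restores the order of `u` and `v`.
  have h2 := (h1.submatrix f).inverse
    (A' := D.map (PowerSeries.map C)) (B' := D.map C)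
    (by rw [Matrix.submatrix_map]; exact Matrix.map_mul_map_eq_one _ hD')
    (by rw [Matrix.submatrix_map]; exact Matrix.map_mul_map_eq_one _ hD)
    (by rw [Matrix.submatrix_map]; exact Matrix.map_mul_map_eq_one _ hD')
    (by rw [Matrix.submatrix_map]; exact Matrix.map_mul_map_eq_one _ hD)
  exact (rtt_iff_isYangianMatrix hD0).1 h2

/-- Entries of a matrix satisfying the super Yangian relations commute with the even entries of
its inverse in disjoint rows and columns. -/
theorem IsYangianMatrix.commute_inverse {p : ι → ℕ} {A B : Matrix ι ι R⟦X⟧}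
    (hA : IsYangianMatrix p A) (h0 : A.map constantCoeff = 1) (hAB : A * B = 1) (hBA : B * A = 1)
    {i j h l : ι} (hjh : j ≠ h) (hil : i ≠ l) (hp : p h = p l) (r s : ℕ) :
    Commute (coeff r (A i j)) (coeff s (B h l)) := by
  have h1 := ((rtt_iff_isYangianMatrix h0).2 hA).mul_inverse
    (Matrix.map_mul_map_eq_one (PowerSeries.map C) hAB)
    (Matrix.map_mul_map_eq_one (PowerSeries.map C) hBA) i j h l
  rw [if_neg hjh, if_neg hil, sub_zero, smul_zero, hp, ← two_mul, mul_left_comm, pow_mul,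
    neg_one_sq, one_pow, one_smul] at h1
  have h2 := congrArg (fun e => coeff r (coeff s e)) (PowerSeries.eq_zero_of_sub_mul_eq_zero h1)
  simp only [Matrix.map_apply, map_sub, coeff_C_mul_map_C, coeff_map_C_mul_C, map_zero] at h2
  exact sub_eq_zero.1 h2

/-- If a ring endomorphism multiplies the entries of `A` by signs, it does so for `A⁻¹`. -/
theorem Matrix.map_inverse_eq_sign_mul {S : Type*} [Ring S] (σ : S →+* S) {p : ι → ℕ}
    {A B : Matrix ι ι S} (hAB : A * B = 1) (hBA : B * A = 1)
    (hσ : ∀ i j, σ (A i j) = (-1 : ℤ) ^ (p i + p j) • A i j) (i j : ι) :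
    σ (B i j) = (-1 : ℤ) ^ (p i + p j) • B i j := by
  set P : Matrix ι ι S := Matrix.signDiagonal ℤ S p 1 with hP
  have hPP : P * P = 1 := Matrix.signDiagonal_mul_self _ _
  have hconj (M : Matrix ι ι S) (i j : ι) :
      (P * M * P) i j = (-1 : ℤ) ^ (p i + p j) • M i j := by
    rw [hP, Matrix.mul_signDiagonal_apply, Matrix.signDiagonal_mul_apply, smul_smul, ← pow_add,
      one_mul, one_mul, add_comm]
  -- On `A`, `σ` acts as conjugation by the involution `P`, and inversion preserves this.
  have hA : A.map σ = P * A * P := by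
    ext i j
    rw [hconj, Matrix.map_apply, hσ]
  have h1 : A.map σ * (P * B * P) = 1 := by
    rw [hA]
    calc _ = P * (A * (P * P) * B) * P := by noncomm_ring
      _ = 1 := by rw [hPP, mul_one, hAB, mul_one, hPP]
  rw [← hconj, ← left_inv_eq_right_inv (Matrix.map_mul_map_eq_one σ hBA) h1, Matrix.map_apply]

end YangianMatrix

/-! ### Relations among the diagonal blocks. -/

section GaussYangian

open PowerSeries Matrix

variable {n : ℕ} {m : Fin n → Type*} [∀ a, Fintype (m a)] [∀ a, DecidableEq (m a)]
  {R : Type*} [Ring R] {A F E : Matrix (Σ a, m a) (Σ a, m a) R⟦X⟧}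
  {D : ∀ a, Matrix (m a) (m a) R⟦X⟧}

omit [∀ a, Fintype (m a)] in
theorem Matrix.leadingBlocks_map_constantCoeff (h0 : A.map constantCoeff = 1) (a : Fin n) :
    (A.leadingBlocks a).map constantCoeff = 1 := by
  rw [leadingBlocks, ← submatrix_map, h0, submatrix_one _ Subtype.val_injective]

theorem Matrix.isUnit_leadingBlocks (h0 : A.map constantCoeff = 1) (a : Fin n) :
    IsUnit (A.leadingBlocks a) :=
  isUnit_of_map_constantCoeff_eq_one (leadingBlocks_map_constantCoeff h0 a)

theorem Matrix.inverse_leadingBlocks_map_constantCoeff (h0 : A.map constantCoeff = 1)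
    (a : Fin n) : (Ring.inverse (A.leadingBlocks a)).map constantCoeff = 1 :=
  map_constantCoeff_eq_one_of_mul_eq_one (leadingBlocks_map_constantCoeff h0 a)
    (Ring.mul_inverse_cancel _ (isUnit_leadingBlocks h0 a))

/-- In a Gauss decomposition the left side is `D_a⁻¹`, so this is the quasideterminant description
of `D_a`. -/
theorem Matrix.blockDiag'_upperFactor (A : Matrix (Σ a, m a) (Σ a, m a) R⟦X⟧) (a : Fin n) :
    blockDiag' A.upperFactor a = (Ring.inverse (A.leadingBlocks a)).submatrix
      (fun i => ⟨⟨a, i⟩, le_rfl⟩) (fun i => ⟨⟨a, i⟩, le_rfl⟩) := by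
  ext i j
  rw [blockDiag'_apply, upperFactor_of_le A (le_refl a)]
  rfl

omit [∀ a, Fintype (m a)] [∀ a, DecidableEq (m a)] in
theorem Matrix.blockInclusion_injective (a : Fin n) : Function.Injective
    fun i : m a => (⟨⟨a, i⟩, le_rfl⟩ : {x : Σ a, m a // x.1 ≤ a}) := by
  intro i j h
  simpa using h

theorem Matrix.blockDiag'_upperFactor_map_constantCoeff (h0 : A.map constantCoeff = 1)
    (a : Fin n) : (blockDiag' A.upperFactor a).map constantCoeff = 1 := by
  rw [blockDiag'_upperFactor, ← submatrix_map, inverse_leadingBlocks_map_constantCoeff h0,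
    submatrix_one _ (blockInclusion_injective a)]

theorem IsYangianMatrix.of_gauss {p : (Σ a, m a) → ℕ} (hA : IsYangianMatrix p A)
    (h0 : A.map constantCoeff = 1) {a : Fin n} (hD : D a * blockDiag' A.upperFactor a = 1)
    (hD' : blockDiag' A.upperFactor a * D a = 1) :
    IsYangianMatrix (fun i => p ⟨a, i⟩) (D a) := by
  rw [blockDiag'_upperFactor] at hD hD'
  have hlead : IsYangianMatrix (fun x : {x : Σ a, m a // x.1 ≤ a} => p x) (A.leadingBlocks a) :=
    fun i j h l r s => hA i j h l r s
  exact hlead.of_inverse_block (leadingBlocks_map_constantCoeff h0 a)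
    (Ring.mul_inverse_cancel _ (isUnit_leadingBlocks h0 a))
    (Ring.inverse_mul_cancel _ (isUnit_leadingBlocks h0 a)) (blockInclusion_injective a) hD hD'

theorem commute_coeff_gauss_of_lt {p : (Σ a, m a) → ℕ} (hA : IsYangianMatrix p A)
    (hp : ∀ a i j, p ⟨a, i⟩ = p ⟨a, j⟩) (h0 : A.map constantCoeff = 1)
    (hD : ∀ a, D a * blockDiag' A.upperFactor a = 1) {a b : Fin n} (hab : a < b)
    (i j : m a) (h l : m b) (r s : ℕ) : Commute (coeff r (D a i j)) (coeff s (D b h l)) := by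
  have hunit := isUnit_leadingBlocks h0
  have hlead : IsYangianMatrix (fun x : {x : Σ a, m a // x.1 ≤ b} => p x) (A.leadingBlocks b) :=
    fun i j h l r s => hA i j h l r s
  have step1 (h l : m b) (s : ℕ) (x y : {x : Σ a, m a // x.1 ≤ a}) (r : ℕ) :
      Commute (coeff r (A.leadingBlocks a x y)) (coeff s (blockDiag' A.upperFactor b h l)) := by
    rw [blockDiag'_upperFactor]
    have hne (x : {x : Σ a, m a // x.1 ≤ a}) (h : m b) :
        (⟨x, x.2.trans hab.le⟩ : {x : Σ a, m a // x.1 ≤ b}) ≠ ⟨⟨b, h⟩, le_rfl⟩ := by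
      intro he
      have he' : x.1.1 = b := congrArg (fun z => z.1.1) he
      exact (x.2.trans_lt hab).ne he'
    exact hlead.commute_inverse (i := ⟨x, x.2.trans hab.le⟩) (j := ⟨y, y.2.trans hab.le⟩)
      (leadingBlocks_map_constantCoeff h0 b) (Ring.mul_inverse_cancel _ (hunit b))
      (Ring.inverse_mul_cancel _ (hunit b)) (hne y h) (hne x l) (hp b h l) r s
  -- `D a` arises from `A_a` by two inversions with a corner taken in between, so its coefficients
  -- stay in the centralizer that contains those of `A_a`.
  have step2 (h l : m b) (s : ℕ) (i j : m a) (r : ℕ) :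
      Commute (coeff r (D a i j)) (coeff s (blockDiag' A.upperFactor b h l)) := by
    set S := Subring.centralizer {coeff s (blockDiag' A.upperFactor b h l)} with hS
    have hmem (c : R) : c ∈ S ↔ Commute c (coeff s (blockDiag' A.upperFactor b h l)) := by
      rw [hS, Subring.mem_centralizer_iff]
      simp [commute_iff_eq, eq_comm]
    refine (hmem _).1 (coeff_mem_of_mul_eq_one S (blockDiag'_upperFactor_map_constantCoeff h0 a)
      (fun i j r => ?_) (hD a) i j r)
    rw [blockDiag'_upperFactor]
    exact coeff_mem_of_mul_eq_one S (leadingBlocks_map_constantCoeff h0 a)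
      (fun x y r => (hmem _).2 (step1 h l s x y r)) (Ring.inverse_mul_cancel _ (hunit a)) _ _ r
  set S := Subring.centralizer {coeff r (D a i j)} with hS
  have hmem (c : R) : c ∈ S ↔ Commute (coeff r (D a i j)) c := by
    rw [hS, Subring.mem_centralizer_iff]
    simp [commute_iff_eq]
  exact (hmem _).1 (coeff_mem_of_mul_eq_one S (blockDiag'_upperFactor_map_constantCoeff h0 b)
    (fun h l s => (hmem _).2 (step2 h l s i j r)) (hD b) h l s)

/-- Parity is constant within a block, so the signs on a diagonal block of `A_a⁻¹` are trivial: `σ`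
fixes that block, hence also its inverse `D a`. -/
theorem map_coeff_gauss {p : (Σ a, m a) → ℕ} (hp : ∀ a i j, p ⟨a, i⟩ = p ⟨a, j⟩)
    (h0 : A.map constantCoeff = 1) (σ : R →+* R)
    (hσ : ∀ x y r, σ (coeff r (A x y)) = (-1 : ℤ) ^ (p x + p y) • coeff r (A x y))
    {a : Fin n} (hD : D a * blockDiag' A.upperFactor a = 1)
    (hD' : blockDiag' A.upperFactor a * D a = 1) (i j : m a) (r : ℕ) :
    σ (coeff r (D a i j)) = coeff r (D a i j) := by
  have hunit := isUnit_leadingBlocks h0 a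
  have hV : (blockDiag' A.upperFactor a).map (PowerSeries.map σ) = blockDiag' A.upperFactor a := by
    rw [blockDiag'_upperFactor]
    ext i j : 1
    rw [map_apply, submatrix_apply, map_inverse_eq_sign_mul (p := fun x => p x.1)
      (PowerSeries.map σ) (Ring.mul_inverse_cancel _ hunit) (Ring.inverse_mul_cancel _ hunit)]
    · rw [hp a i j, ← two_mul, pow_mul, neg_one_sq, one_pow, one_smul]
    · intro x y
      ext r
      rw [PowerSeries.coeff_map, map_zsmul]
      exact hσ x.1 y.1 r
  have h1 := Matrix.map_mul_map_eq_one (PowerSeries.map σ) hD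
  rw [hV] at h1
  have h2 : (D a).map (PowerSeries.map σ) i j = D a i j := by rw [left_inv_eq_right_inv h1 hD']
  conv_rhs => rw [← h2, Matrix.map_apply, PowerSeries.coeff_map]

/-- The properties of the diagonal blocks of a block Gauss decomposition of a matrix that satisfies
the super Yangian relations, with block sizes compatible with the parity. -/
theorem gauss_properties {π : Fin n → ℕ} (hA : IsYangianMatrix (fun x => π x.1) A)
    (h0 : A.map constantCoeff = 1) (hF : F.IsBlockUnitriangular fun x => n - x.1)
    (hE : E.IsBlockUnitriangular fun x => x.1) (h : A = F * blockDiagonal' D * E) (σ : R →+* R)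
    (hσ : ∀ x y r, σ (coeff r (A x y)) = (-1 : ℤ) ^ (π x.1 + π y.1) • coeff r (A x y)) :
    (∀ a, IsUnit (D a)) ∧ (∀ a, (D a).map constantCoeff = 1) ∧
      (∀ a i j r, σ (coeff r (D a i j)) = coeff r (D a i j)) ∧
      (∀ a, IsYangianMatrix (fun _ => π a) (D a)) ∧
      ∀ a b, a ≠ b → ∀ i j h k r s, Commute (coeff r (D a i j)) (coeff s (D b h k)) := by
  have hunit := isUnit_of_map_constantCoeff_eq_one h0
  have hlead := isUnit_leadingBlocks h0
  obtain ⟨hDV, -⟩ := gauss_eq hunit hlead hF hE h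
  have hp (a : Fin n) (i j : m a) : (fun x : Σ a, m a => π x.1) ⟨a, i⟩ =
    (fun x : Σ a, m a => π x.1) ⟨a, j⟩ := rfl
  refine ⟨fun a => isUnit_iff_exists.2 ⟨_, (hDV a).1, (hDV a).2⟩, fun a =>
    map_constantCoeff_eq_one_of_mul_eq_one (blockDiag'_upperFactor_map_constantCoeff h0 a)
      (hDV a).2, fun a i j r => map_coeff_gauss hp h0 σ hσ (hDV a).1 (hDV a).2 i j r,
    fun a => hA.of_gauss h0 (hDV a).1 (hDV a).2, fun a b hab i j h k r s => ?_⟩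
  rcases lt_or_gt_of_ne hab with hlt | hlt
  · exact commute_coeff_gauss_of_lt hA hp h0 (fun a => (hDV a).1) hlt i j h k r s
  · exact (commute_coeff_gauss_of_lt hA hp h0 (fun a => (hDV a).1) hlt h k i j s r).symm

end GaussYangian

/-! ### Application to `T(u)` and the Levi subalgebra. -/

namespace SuperYangian

open PowerSeries Matrix

theorem isYangianMatrix_T (M N : ℕ) : IsYangianMatrix (parity M) (T M N) := by
  intro i j h l r s
  have key := mk_eq (Rel.bracket i j h l r s)
  simp only [map_sub, map_mul, map_smul, map_sum] at key
  simp only [neg_one_pow_smul_eq_zsmul] at key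
  simp only [T, of_apply, coeff_mk]
  exact key

theorem T_map_constantCoeff (M N : ℕ) : (T M N).map constantCoeff = 1 := by
  ext i j
  rw [map_apply, ← coeff_zero_eq_constantCoeff_apply, T, of_apply, coeff_mk, t,
    mk_eq (Rel.zero i j), one_apply]
  split_ifs <;> simp

theorem parityAut_t {M N : ℕ} (i j : Fin (M + N)) (r : ℕ) :
    parityAut M N (t i j r) = (-1 : ℤ) ^ (parity M i + parity M j) • t i j r := by
  rw [t, parityAut, lift_mk, AlgHom.comp_apply, Free.sign_t, map_smul, neg_one_pow_smul_eq_zsmul]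

/-- The only sign comes from two odd components, so evenness of one argument is enough. -/
theorem superBracket_of_parityAut_eq {M N : ℕ} (x : SuperYangian M N) {y : SuperYangian M N}
    (hy : parityAut M N y = y) : superBracket x y = x * y - y * x := by
  have h1 : evenPart y = y := by
    rw [evenPart, hy, ← two_smul ℂ y, smul_smul]
    norm_num
  have h2 : oddPart y = 0 := by rw [oddPart, hy, sub_self, smul_zero]
  have h3 : evenPart x + oddPart x = x := by
    rw [evenPart, oddPart, ← smul_add, add_add_sub_cancel, ← two_smul ℂ x, smul_smul]
    norm_num
  rw [superBracket, h1, h2, zero_mul, zero_mul, add_zero, sub_zero, ← mul_add, h3]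

theorem parity_blocksFinEquiv {M N : ℕ} (lam : Composition M) (nu : Composition N)
    (x : BlockIndex (lam.append nu)) :
    parity M ((lam.append nu).blocksFinEquiv x) = blockParity lam nu x.1 := by
  obtain ⟨a, i⟩ := x
  have hval : (((lam.append nu).blocksFinEquiv ⟨a, i⟩ : Fin (M + N)) : ℕ) =
      (lam.append nu).sizeUpTo a + i := rfl
  -- The cut between even and odd indices falls on a block boundary, so no block mixes parities.
  have hsize : (lam.append nu).sizeUpTo lam.length = M := by
    simp [Composition.sizeUpTo, Composition.length]
  rw [parity, blockParity, hval]
  congr 1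
  refine propext ⟨fun h => ?_, fun h => ?_⟩
  · by_contra hle
    have h1 := (lam.append nu).monotone_sizeUpTo (not_lt.1 hle)
    dsimp only at h1
    omega
  · have h1 := (lam.append nu).monotone_sizeUpTo (Nat.succ_le_of_lt h)
    have h2 := (lam.append nu).sizeUpTo_succ' a
    have h3 : (i : ℕ) < (lam.append nu).blocksFun a := i.2
    dsimp only [Nat.succ_eq_add_one] at h1
    omega

theorem isGaussDecomposition_iff {R : Type*} [Ring R] {n : ℕ} {c : Composition n}
    {A : Matrix (Fin n) (Fin n) R} {F E : Matrix (BlockIndex c) (BlockIndex c) R}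
    {D : (a : Fin c.length) → Matrix (Fin (c.blocksFun a)) (Fin (c.blocksFun a)) R} :
    IsGaussDecomposition c A F D E ↔
      (F.IsBlockUnitriangular fun x => c.length - x.1) ∧ (E.IsBlockUnitriangular fun x => x.1) ∧
        A.submatrix c.blocksFinEquiv c.blocksFinEquiv = F * blockDiagonal' D * E := by
  constructor
  · rintro ⟨h1, h2, h3, h4, h5⟩
    exact ⟨isBlockUnitriangular_sub_fst h1 h2, isBlockUnitriangular_fst h3 h4, h5⟩
  · rintro ⟨hF, hE, h⟩
    refine ⟨fun x y hxy => ?_, fun a => ?_, fun x y hxy => ?_, hE.blockDiag'_eq_one, h⟩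
    · rw [hF x y (by have := Fin.lt_def.1 hxy; simp only; omega), one_apply_ne]
      rintro rfl
      exact hxy.false
    · ext i j
      rw [blockDiag'_apply, hF ⟨a, i⟩ ⟨a, j⟩ le_rfl]
      simp [one_apply]
    · rw [hE x y (Fin.lt_def.1 hxy).le, one_apply_ne]
      rintro rfl
      exact hxy.false

/-- A block Gauss decomposition of an invertible matrix with invertible leading block
submatrices exists and is unique. -/
theorem existsUnique_isGaussDecomposition {R : Type*} [Ring R] {n : ℕ} {c : Composition n}
    {A : Matrix (Fin n) (Fin n) R⟦X⟧} (h0 : A.map constantCoeff = 1) :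
    ∃! G : Matrix (BlockIndex c) (BlockIndex c) R⟦X⟧ ×
        ((a : Fin c.length) → Matrix (Fin (c.blocksFun a)) (Fin (c.blocksFun a)) R⟦X⟧) ×
        Matrix (BlockIndex c) (BlockIndex c) R⟦X⟧,
      IsGaussDecomposition c A G.1 G.2.1 G.2.2 := by
  set B := A.submatrix c.blocksFinEquiv c.blocksFinEquiv with hB
  have hB0 : B.map constantCoeff = 1 := by
    rw [hB, ← submatrix_map, h0, submatrix_one_equiv]
  have hunit := isUnit_leadingBlocks hB0
  obtain ⟨F, D, E, hF, hE, h⟩ := exists_gauss hunit fun a =>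
    isUnit_of_map_constantCoeff_eq_one (blockDiag'_upperFactor_map_constantCoeff hB0 a)
  refine ⟨⟨F, D, E⟩, isGaussDecomposition_iff.2 ⟨hF, hE, h⟩, ?_⟩
  rintro ⟨F', D', E'⟩ h'
  obtain ⟨hF', hE', h'⟩ := isGaussDecomposition_iff.1 h'
  have hBunit := isUnit_of_map_constantCoeff_eq_one hB0
  obtain ⟨h1, h2, h3, h4⟩ := gauss_eq hBunit hunit hF hE h
  obtain ⟨h1', h2', h3', h4'⟩ := gauss_eq hBunit hunit hF' hE' h'
  -- Both invert the same block of the upper factor `V`; then `F = B * V` and `E = (V * D)⁻¹` are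
  -- determined too.
  have hD : D' = D := funext fun a => left_inv_eq_right_inv (h1' a).1 (h1 a).2
  simp only at hD h2' h4'
  subst hD
  rw [h2', ← h2, left_inv_eq_right_inv h4' h3]

/-- The properties of the diagonal blocks of a block Gauss decomposition of `T(u)` whose block
sizes are compatible with the parity. -/
theorem gauss_T_properties {M N : ℕ} {c : Composition (M + N)} {π : Fin c.length → ℕ}
    (hπ : ∀ x, parity M (c.blocksFinEquiv x) = π x.1)
    {F E : Matrix (BlockIndex c) (BlockIndex c) (SuperYangian M N)⟦X⟧}
    {D : (a : Fin c.length) →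
      Matrix (Fin (c.blocksFun a)) (Fin (c.blocksFun a)) (SuperYangian M N)⟦X⟧}
    (hG : IsGaussDecomposition c (T M N) F D E) :
    (∀ a, IsUnit (D a)) ∧ (∀ a, (D a).map constantCoeff = 1) ∧
      (∀ a i j r, parityAut M N (entryCoeff (D a) i j r) = entryCoeff (D a) i j r) ∧
      (∀ a, IsYangianMatrix (fun _ => π a) (D a)) ∧
      ∀ a b, a ≠ b → ∀ i j h k r s,
        Commute (entryCoeff (D a) i j r) (entryCoeff (D b) h k s) := by
  obtain ⟨hF, hE, h⟩ := isGaussDecomposition_iff.1 hG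
  set A := (T M N).submatrix c.blocksFinEquiv c.blocksFinEquiv with hA
  have hA0 : A.map constantCoeff = 1 := by
    rw [hA, ← submatrix_map, T_map_constantCoeff, submatrix_one_equiv]
  have hAY : IsYangianMatrix (fun x : BlockIndex c => π x.1) A := by
    intro i j h l r s
    simp only [← hπ]
    exact isYangianMatrix_T M N _ _ _ _ r s
  refine gauss_properties (m := fun a => Fin (c.blocksFun a)) hAY hA0 hF hE h
    (parityAut M N : SuperYangian M N →+* SuperYangian M N) fun x y r => ?_
  simp only [hA, submatrix_apply, T, of_apply, coeff_mk, ← hπ]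
  exact parityAut_t _ _ r

theorem sum_entryCoeff_mul_inverse {R m : Type*} [Ring R] [Fintype m] [DecidableEq m]
    {D : Matrix m m R⟦X⟧} (hD : IsUnit D) (i j : m) (r : ℕ) :
    ∑ q ∈ Finset.range (r + 1), ∑ p,
      entryCoeff D i p q * entryCoeff (Ring.inverse D) p j (r - q) =
        if r = 0 ∧ i = j then 1 else 0 := by
  have hmul : (D * Ring.inverse D) i j = (1 : Matrix m m R⟦X⟧) i j := by
    rw [Ring.mul_inverse_cancel _ hD]
  have hcoeff := congrArg (coeff r) hmul
  rw [mul_apply, map_sum] at hcoeff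
  simp only [coeff_mul] at hcoeff
  rw [Finset.sum_comm, Finset.Nat.sum_antidiagonal_eq_sum_range_succ_mk] at hcoeff
  refine hcoeff.trans ?_
  rw [one_apply]
  by_cases hij : i = j <;> simp [hij, coeff_one]

theorem levi_eq_adjoin {M N : ℕ} {c : Composition (M + N)}
    {D : (a : Fin c.length) →
      Matrix (Fin (c.blocksFun a)) (Fin (c.blocksFun a)) (SuperYangian M N)⟦X⟧}
    (hD : ∀ a, IsUnit (D a)) (hD0 : ∀ a, (D a).map constantCoeff = 1) :
    levi D = Algebra.adjoin ℂ (coeffSet D) := by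
  refine le_antisymm (Algebra.adjoin_le (Set.union_subset Algebra.subset_adjoin ?_))
    (Algebra.adjoin_mono Set.subset_union_left)
  rintro _ ⟨a, i, j, r, rfl⟩
  exact coeff_mem_of_mul_eq_one (Algebra.adjoin ℂ (coeffSet D)).toSubring (hD0 a)
    (fun i j r => Algebra.subset_adjoin ⟨a, i, j, r, rfl⟩)
    (Ring.inverse_mul_cancel _ (hD a)) i j r

end SuperYangian

open SuperYangian in
theorem proposition4p5 (M N : ℕ) (lam : Composition M) (nu : Composition N) :
    -- `T(u)` has exactly one Gauss decomposition of shape `(lam | nu)`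
    (∃! G : Matrix (BlockIndex (lam.append nu)) (BlockIndex (lam.append nu)) (SuperYangian M N)⟦X⟧ ×
        ((a : Fin (lam.append nu).length) →
          Matrix (Fin ((lam.append nu).blocksFun a)) (Fin ((lam.append nu).blocksFun a))
            (SuperYangian M N)⟦X⟧) ×
        Matrix (BlockIndex (lam.append nu)) (BlockIndex (lam.append nu)) (SuperYangian M N)⟦X⟧,
      IsGaussDecomposition (lam.append nu) (T M N) G.1 G.2.1 G.2.2) ∧
    ∀ (F : Matrix (BlockIndex (lam.append nu)) (BlockIndex (lam.append nu)) (SuperYangian M N)⟦X⟧)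
      (D : (a : Fin (lam.append nu).length) →
        Matrix (Fin ((lam.append nu).blocksFun a)) (Fin ((lam.append nu).blocksFun a))
          (SuperYangian M N)⟦X⟧)
      (E : Matrix (BlockIndex (lam.append nu)) (BlockIndex (lam.append nu)) (SuperYangian M N)⟦X⟧),
      IsGaussDecomposition (lam.append nu) (T M N) F D E →
      -- `D_a(u)` is invertible, so that `D'_a(u)` is its inverse
      (∀ a, IsUnit (D a)) ∧
      (∀ a i j, entryCoeff (D a) i j 0 = if i = j then 1 else 0) ∧
      (∀ a i j r,
        ∑ q ∈ Finset.range (r + 1), ∑ p,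
            entryCoeff (D a) i p q * entryCoeff (Ring.inverse (D a)) p j (r - q) =
          if r = 0 ∧ i = j then 1 else 0) ∧
      (∀ a b, a ≠ b → ∀ i j h k r s,
        superBracket (entryCoeff (D a) i j r) (entryCoeff (D b) h k s) = 0) ∧
      (∀ a i j h k r s,
        superBracket (entryCoeff (D a) i j r) (entryCoeff (D a) h k s) =
          (-1 : ℂ) ^ blockParity lam nu a •
            ∑ q ∈ Finset.range (min r s),
              (entryCoeff (D a) h j q * entryCoeff (D a) i k (r + s - 1 - q)
                - entryCoeff (D a) h j (r + s - 1 - q) * entryCoeff (D a) i k q)) ∧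
      -- the standard Levi subalgebra is already generated by the `D_{a;i,j}^{(r)}`
      levi D = Algebra.adjoin ℂ (coeffSet D) := by
  refine ⟨existsUnique_isGaussDecomposition (T_map_constantCoeff M N), ?_⟩
  intro F D E hG
  obtain ⟨hunit, hD0, heven, hY, hcomm⟩ :=
    gauss_T_properties (fun x => parity_blocksFinEquiv lam nu x) hG
  refine ⟨hunit, fun a i j => ?_, fun a i j r => sum_entryCoeff_mul_inverse (hunit a) i j r,
    fun a b hab i j h k r s => ?_, fun a i j h k r s => ?_, levi_eq_adjoin hunit hD0⟩
  · have := congrFun (congrFun (hD0 a) i) j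
    rwa [Matrix.map_apply, ← PowerSeries.coeff_zero_eq_constantCoeff_apply,
      Matrix.one_apply] at this
  · rw [superBracket_of_parityAut_eq _ (heven b h k s), sub_eq_zero]
    exact hcomm a b hab i j h k r s
  · rw [superBracket_of_parityAut_eq _ (heven a h k s), neg_one_pow_smul_eq_zsmul]
    have key := hY a i j h k r s
    -- With all four parities equal to `q`, the supercommutator sign is trivial and the exponent `3
    -- * q ^ 2` on the right has the parity of `q`.
    generalize blockParity lam nu a = q at key ⊢
    rw [Even.neg_one_pow ((Even.add_self q).mul_right _), one_smul,
      neg_one_pow_congr (n := q) (by simp only [Nat.even_add, Nat.even_mul]; tauto)] at key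
    exact key
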